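/- Let $\mathcal{C}$ be a category with finite limits and let $G$ be an internal group in $\mathcal{C}$. Write $[G,\mathcal{C}]$ for the category of $G$-objects $(A,*)$, where $*:G\times A\to A$ is an action, with $G$-homomorphisms as morphisms, and $G^*:\mathcal{C}\to[G,\mathcal{C}]$ for the functor sending $X$ to $X$ with the trivial action $(X,\pi_2)$. An adjunction $L\dashv R$, with $L:\mathcal{D}\to\mathcal{E}$, between categories with finite limits satisfies Frobenius reciprocity if the canonical morphism $(\varepsilon_Y\circ L\pi_1, L\pi_2): L(RY\times W)\to Y\times LW$ is an isomorphism for all $Y\in\mathcal{E}$, $W\in\mathcal{D}$, where $\varepsilon$ is the counit. It is stably Frobenius if for every $Y\in\mathcal{E}$ the induced adjunction $L_Y\dashv R_Y:\mathcal{D}/RY\rightleftarrows\mathcal{E}/Y$ satisfies Frobenius reciprocity, where $L_Y$ sends $g:W\to RY$ to its transpose $LW\to Y$ and $R_Y$ sends $f$ to $Rf$. Suppose that $G^*$ has a left adjoint $\Sigma_G$ and that $\Sigma_G\dashv G^*$ is stably Frobenius. Let $X$ be an object of $\mathcal{C}$. Then the following two categories are equivalent. 1. The category of principal $G$-bundles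 over $X$. Its objects are $G$-objects $(P,*)$ with a morphism $f:P\to X$ such that (i) $f\circ *=f\circ\pi_2$; (ii) $f$ is an effective descent morphism, i.e. the pullback functor $f^*:\mathcal{C}/X\to\mathcal{C}/P$ is monadic; (iii) $(*,\pi_2):G\times P\to P\times_XP$ is an isomorphism. Its morphisms are the $G$-homomorphisms commuting with the morphisms to $X$. 2. The category of stably Frobenius adjunctions $L\dashv R:\mathcal{C}/X\rightleftarrows[G,\mathcal{C}]$ over $\mathcal{C}$. Its objects are stably Frobenius adjunctions $L\dashv R$, with $L:\mathcal{C}/X\to[G,\mathcal{C}]$, together with a natural isomorphism $\theta:\Sigma_GL\cong\Sigma_X$, where $\Sigma_X:\mathcal{C}/X\to\mathcal{C}$ is the forgetful functor. Its morphisms $(L\dashv R,\theta)\to(L'\dashv R',\theta')$ are the natural transformations $\tau:L\to L'$ over $\mathcal{C}$, i.e. such that $\theta'\circ\Sigma_G\tau=\theta$. -/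

import Mathlib

open CategoryTheory Limits MonoidalCategory CartesianMonoidalCategory
open scoped MonObj

universe v u v₁ u₁ v₂ u₂

noncomputable section

namespace PrincipalBundles

section GObjects

variable {C : Type u} [Category.{v} C] [CartesianMonoidalCategory C]

/-- The category `[G, C]` of `G`-objects and `G`-homomorphisms, for an internal group `G`. -/
abbrev GObj (G : C) [GrpObj G] := Mod C G

/-- The `G`-object `(X, π₂)`: the object `X` with the trivial action. -/
def trivialGObj (G : C) [GrpObj G] (X : C) : GObj G :=
  letI : ModObj G X := ModObj.trivialAction G X
  ⟨X⟩

/-- The functor `G^* : C ⥤ [G, C]`, sending `X` to `(X, π₂)`. -/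
def trivialFunctor (G : C) [GrpObj G] : C ⥤ GObj G where
  obj X := trivialGObj G X
  map {X Y} f := Mod.Hom.mk' (M := trivialGObj G X) (N := trivialGObj G Y) f
    (by exact (whiskerLeft_snd G f).symm)

/-- The action morphism `G × A ⟶ A` of a `G`-object. -/
def act {G : C} [GrpObj G] (A : GObj G) : G ⊗ A.X ⟶ A.X := γ[G, A.X]

section Limits

variable {G : C} [GrpObj G] {J : Type u₁} [Category.{v₁} J]

lemma one_act (A : GObj G) : η[G] ▷ A.X ≫ act A = (λ_ A.X).hom :=
  ModObj.one_smul_self G A.X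

lemma mul_act (A : GObj G) :
    μ[G] ▷ A.X ≫ act A = (α_ G G A.X).hom ≫ G ◁ act A ≫ act A :=
  ModObj.mul_smul_self G A.X

lemma act_hom {A B : GObj G} (f : A ⟶ B) : act A ≫ f.hom = G ◁ f.hom ≫ act B :=
  IsModHom.smul_hom

/-- A leg of a cone over the underlying diagram of a diagram of `G`-objects. -/
def leg {F : J ⥤ GObj G} (c : Cone (F ⋙ Mod.forget G)) (j : J) : c.pt ⟶ (F.obj j).X :=
  c.π.app j

lemma leg_w {F : J ⥤ GObj G} (c : Cone (F ⋙ Mod.forget G)) {i j : J} (f : i ⟶ j) :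
    leg c i ≫ (F.map f).hom = leg c j :=
  c.w f

lemma leg_ext {F : J ⥤ GObj G} {c : Cone (F ⋙ Mod.forget G)} (hc : IsLimit c) {Z : C}
    {a b : Z ⟶ c.pt} (h : ∀ j, a ≫ leg c j = b ≫ leg c j) : a = b :=
  hc.hom_ext h

/-- The action on a limit of `G`-objects. -/
def limitAct (F : J ⥤ GObj G) (c : Cone (F ⋙ Mod.forget G)) (hc : IsLimit c) :
    G ⊗ c.pt ⟶ c.pt :=
  hc.lift
    { pt := G ⊗ c.pt
      π :=
        { app := fun j => G ◁ leg c j ≫ act (F.obj j)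
          naturality := fun i j f => by
            have h : G ◁ leg c j ≫ act (F.obj j) =
                (G ◁ leg c i ≫ act (F.obj i)) ≫ (F.map f).hom := by
              rw [Category.assoc, act_hom, ← leg_w c f, MonoidalCategory.whiskerLeft_comp,
                Category.assoc]
            exact (Category.id_comp _).trans h } }

lemma limitAct_leg (F : J ⥤ GObj G) (c : Cone (F ⋙ Mod.forget G)) (hc : IsLimit c) (j : J) :
    limitAct F c hc ≫ leg c j = G ◁ leg c j ≫ act (F.obj j) :=
  hc.fac _ j

lemma one_limitAct (F : J ⥤ GObj G) (c : Cone (F ⋙ Mod.forget G)) (hc : IsLimit c) :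
    η[G] ▷ c.pt ≫ limitAct F c hc = (λ_ c.pt).hom := by
  refine leg_ext hc fun j => ?_
  rw [Category.assoc, limitAct_leg, ← whisker_exchange_assoc, one_act, leftUnitor_naturality]

lemma mul_limitAct (F : J ⥤ GObj G) (c : Cone (F ⋙ Mod.forget G)) (hc : IsLimit c) :
    μ[G] ▷ c.pt ≫ limitAct F c hc =
      (α_ G G c.pt).hom ≫ G ◁ limitAct F c hc ≫ limitAct F c hc := by
  refine leg_ext hc fun j => ?_
  simp only [Category.assoc]
  rw [limitAct_leg, ← whisker_exchange_assoc, mul_act, ← MonoidalCategory.whiskerLeft_comp_assoc,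
    limitAct_leg]
  simp

/-- The limit of a diagram of `G`-objects, formed in `C`. -/
def limitGObj (F : J ⥤ GObj G) (c : Cone (F ⋙ Mod.forget G)) (hc : IsLimit c) : GObj G :=
  letI : ModObj G c.pt :=
    { smul := limitAct F c hc
      one_smul := one_limitAct F c hc
      mul_smul := mul_limitAct F c hc }
  ⟨c.pt⟩

/-- The limit cone on `limitGObj`. -/
def limitGObjCone (F : J ⥤ GObj G) (c : Cone (F ⋙ Mod.forget G)) (hc : IsLimit c) : Cone F where
  pt := limitGObj F c hc
  π :=
    { app := fun j => Mod.Hom.mk' (M := limitGObj F c hc) (N := F.obj j) (leg c j)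
        (limitAct_leg F c hc j)
      naturality := fun _ _ f => Mod.hom_ext _ _ (c.π.naturality f) }

/-- `limitGObjCone` is a limit cone. -/
def limitGObjConeIsLimit (F : J ⥤ GObj G) (c : Cone (F ⋙ Mod.forget G)) (hc : IsLimit c) :
    IsLimit (limitGObjCone F c hc) where
  lift s := Mod.Hom.mk' (M := s.pt) (N := limitGObj F c hc)
    (hc.lift ((Mod.forget G).mapCone s)) (by
      have key : ∀ l : s.pt.X ⟶ c.pt, (∀ j, l ≫ leg c j = (s.π.app j).hom) →
          act s.pt ≫ l = G ◁ l ≫ limitAct F c hc := by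
        intro l hl
        refine leg_ext hc fun j => ?_
        rw [Category.assoc, Category.assoc, limitAct_leg, hl, act_hom,
          ← MonoidalCategory.whiskerLeft_comp_assoc, hl]
      exact key _ fun j => hc.fac _ j)
  fac s j := Mod.hom_ext _ _ (hc.fac _ j)
  uniq s m hm := Mod.hom_ext _ _
    (hc.uniq ((Mod.forget G).mapCone s) m.hom fun j => congrArg Mod.Hom.hom (hm j))

/-- `[G, C]` is a cartesian category when `C` is. -/
instance hasFiniteLimits_gObj [HasFiniteLimits C] : HasFiniteLimits (GObj G) where
  out _ _ _ :=
    { has_limit := fun F =>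
        ⟨⟨⟨limitGObjCone F _ (limit.isLimit (F ⋙ Mod.forget G)),
          limitGObjConeIsLimit F _ (limit.isLimit (F ⋙ Mod.forget G))⟩⟩⟩ }

end Limits
end GObjects

section Frobenius

variable {D : Type u₁} [Category.{v₁} D] {E : Type u₂} [Category.{v₂} E]

/-- The canonical morphism `L (R Y × W) ⟶ Y × L W` of an adjunction `L ⊣ R`. -/
def frobeniusMap [HasBinaryProducts D] [HasBinaryProducts E] {L : D ⥤ E} {R : E ⥤ D}
    (adj : L ⊣ R) (Y : E) (W : D) : L.obj (R.obj Y ⨯ W) ⟶ Y ⨯ L.obj W :=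
  prod.lift (L.map prod.fst) (L.map prod.snd) ≫ prod.map (adj.counit.app Y) (𝟙 (L.obj W))

/-- Frobenius reciprocity for an adjunction between categories with binary products. -/
def IsFrobenius [HasBinaryProducts D] [HasBinaryProducts E] {L : D ⥤ E} {R : E ⥤ D}
    (adj : L ⊣ R) : Prop :=
  ∀ (Y : E) (W : D), IsIso (frobeniusMap adj Y W)

/-- An adjunction `L ⊣ R` between cartesian categories is stably Frobenius if, for every object
`Y`, the induced adjunction `L_Y ⊣ R_Y` between `D / R Y` and `E / Y` satisfies Frobenius
reciprocity. Here `L_Y` sends `g : W ⟶ R Y` to its transpose `L g ≫ ε : L W ⟶ Y`,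
and `R_Y` sends `f` to `R f`. -/
def IsStablyFrobenius [HasFiniteLimits D] [HasFiniteLimits E] {L : D ⥤ E} {R : E ⥤ D}
    (adj : L ⊣ R) : Prop :=
  ∀ Y : E, IsFrobenius (Over.postAdjunctionRight (Y := Y) adj)

end Frobenius

section Bundles

variable {C : Type u} [Category.{v} C]

/-- `f : X ⟶ Y` is an effective descent morphism if the pullback functor `C/Y ⥤ C/X`
is monadic. -/
def IsEffectiveDescent [HasPullbacks C] {X Y : C} (f : X ⟶ Y) : Prop :=
  Nonempty (MonadicRightAdjoint (Over.pullback f))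

variable [CartesianMonoidalCategory C] [HasFiniteLimits C]

/-- A principal `G`-bundle over `X`. -/
structure PrincipalBundle (G : C) [GrpObj G] (X : C) where
  /-- the underlying `G`-object `(P, *)` -/
  P : GObj G
  /-- the bundle morphism -/
  f : P.X ⟶ X
  /-- `f (g * p) = f p` -/
  smul_f : act P ≫ f = snd G P.X ≫ f
  effectiveDescent : IsEffectiveDescent f
  /-- the morphism `(*, π₂) : G × P ⟶ P ×_X P` is an isomorphism -/
  isIso_shear : IsIso (pullback.lift (f := f) (g := f) (act P) (snd G P.X) smul_f)

namespace PrincipalBundle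

variable {G : C} [GrpObj G] {X : C}

/-- Morphisms of principal `G`-bundles over `X` are `G`-homomorphisms over `X`. -/
@[ext]
structure Hom (A B : PrincipalBundle G X) where
  hom : A.P ⟶ B.P
  w : hom.hom ≫ B.f = A.f

instance : Category (PrincipalBundle G X) where
  Hom := Hom
  id A := ⟨𝟙 A.P, by simp⟩
  comp a b := ⟨a.hom ≫ b.hom, by simp [a.w, b.w]⟩

end PrincipalBundle

/-- An adjunction `L ⊣ R` between `C/X` and `[G, C]` that is stably Frobenius and is over `C`,
with respect to a left adjoint `S` of `G^*`. The functor `Over.forget X : C/X ⥤ C` is `Σ_X`,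
and `overIso` exhibits `S L` as `Σ_X`. -/
structure StablyFrobeniusAdjunctionOver {G : C} [GrpObj G] (S : GObj G ⥤ C) (X : C) where
  L : Over X ⥤ GObj G
  R : GObj G ⥤ Over X
  adj : L ⊣ R
  overIso : L ⋙ S ≅ Over.forget X
  stablyFrobenius : IsStablyFrobenius adj

namespace StablyFrobeniusAdjunctionOver

variable {G : C} [GrpObj G] {S : GObj G ⥤ C} {X : C}

/-- Morphisms are the natural transformations over `C` between the left adjoints. -/
@[ext]
structure Hom (A B : StablyFrobeniusAdjunctionOver S X) where
  τ : A.L ⟶ B.L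
  w : Functor.whiskerRight τ S ≫ B.overIso.hom = A.overIso.hom

instance : Category (StablyFrobeniusAdjunctionOver S X) where
  Hom := Hom
  id A := ⟨𝟙 A.L, by simp⟩
  comp a b := ⟨a.τ ≫ b.τ, by simp [a.w, b.w]⟩

end StablyFrobeniusAdjunctionOver

end Bundles

end PrincipalBundles

end

noncomputable section

namespace PrincipalBundles

/-! ### Stable Frobenius reciprocity as a pullback condition -/

section Frobenius

/-! An adjunction `L ⊣ R` over `C` is determined by `P = L 1`, where `1` is the terminal object of
`C/X`. Stable Frobenius reciprocity says that transposition preserves certain pullbacks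
(`isStablyFrobenius_iff`); applied to the unit at `1`, it shows that every `T ⟶ L 1` is, up to
isomorphism, `L` of some `V ⟶ 1`. Since `Σ_G L ≅ Σ_X`, the functor `L` is faithful and conservative,
and it follows that `C/X ≃ [G, C]/P`. Consequently `L W` is `P ×_X W`, with `W` acted on trivially
(`isPullback_toBase`). The same pullback for the free `G`-object on `P`, whose orbit object is `P`,
is the shear isomorphism. Pulling back along `f : P ⟶ X` is `L` followed by forgetting the action,
and Beck's theorem gives effective descent.

Conversely, let `P` be principal and `T ⟶ P` equivariant. The action and the projection `G × T ⇉ T`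
have coequalizer `Σ_G T` over `X`; after pullback along `f` they have the split coequalizer `T`,
through `(a, p) ↦ (p / a) • a`. Monadicity of `f^*` then yields `T ≅ Σ_G T ×_X P`, whence `[G, C]/P
≃ C/X`. Composing with the adjunction between `[G, C]/P` and `[G, C]` gives a stably Frobenius
adjunction over `C`.

On morphisms, `L W ≅ P ×_X W` shows that a transformation over `C` amounts to its component at `1`,
which is a bundle morphism. -/

lemma _root_.CategoryTheory.IsPullback.of_isIso_comp {E : Type u₂} [Category.{v₂} E]
    {T A B Z : E} {a : T ⟶ A} {b : T ⟶ B} {f : A ⟶ Z} {g : B ⟶ Z} (h : IsPullback a b f g)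
    {T' : E} (e : T' ⟶ T) [IsIso e] {a' : T' ⟶ A} {b' : T' ⟶ B} (ha : e ≫ a = a')
    (hb : e ≫ b = b') : IsPullback a' b' f g :=
  h.of_iso (asIso e).symm (Iso.refl _) (Iso.refl _) (Iso.refl _) (by simp [← ha])
    (by simp [← hb]) (by simp) (by simp)

/-- Replaces invertibility of a Frobenius map by a universal property of its two components, which
in a slice is a pullback square. -/
lemma nonempty_isLimit_binaryFan_iff_isIso {E : Type u₂} [Category.{v₂} E] {Y Z T : E}
    [HasBinaryProduct Y Z] (h : T ⟶ Y ⨯ Z) {a : T ⟶ Y} {b : T ⟶ Z}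
    (ha : h ≫ prod.fst = a) (hb : h ≫ prod.snd = b) :
    Nonempty (IsLimit (BinaryFan.mk a b)) ↔ IsIso h := by
  constructor
  · rintro ⟨l⟩
    have : h = (l.conePointUniqueUpToIso (prodIsProd Y Z)).hom := by
      apply prod.hom_ext
      · rw [ha]
        exact (l.conePointUniqueUpToIso_hom_comp (prodIsProd Y Z) ⟨WalkingPair.left⟩).symm
      · rw [hb]
        exact (l.conePointUniqueUpToIso_hom_comp (prodIsProd Y Z) ⟨WalkingPair.right⟩).symm
    rw [this]
    infer_instance
  · intro _
    exact ⟨IsLimit.ofIsoLimit (prodIsProd Y Z)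
      (BinaryFan.ext (asIso h).symm (by simp [← ha]) (by simp [← hb]))⟩

lemma nonempty_isLimit_binaryFan_over_iff {E : Type u₂} [Category.{v₂} E] {X : E}
    {A B T : Over X} (a : T ⟶ A) (b : T ⟶ B) :
    Nonempty (IsLimit (BinaryFan.mk a b)) ↔ IsPullback a.left b.left A.hom B.hom := by
  constructor
  · rintro ⟨l⟩
    exact ⟨⟨(Over.w a).trans (Over.w b).symm⟩,
      ⟨IsLimit.pullbackConeEquivBinaryFanInverse (f := A.hom) (g := B.hom) l⟩⟩
  · intro h
    have w {Q : Over X} (x : Q ⟶ A) (y : Q ⟶ B) : x.left ≫ A.hom = y.left ≫ B.hom :=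
      (Over.w x).trans (Over.w y).symm
    let lift {Q : Over X} (x : Q ⟶ A) (y : Q ⟶ B) : Q ⟶ T :=
      Over.homMk (h.lift x.left y.left (w x y)) (by
        rw [← Over.w a, h.lift_fst_assoc, Over.w x])
    have lift_a {Q : Over X} (x : Q ⟶ A) (y : Q ⟶ B) : lift x y ≫ a = x :=
      Over.OverMorphism.ext (h.lift_fst _ _ (w x y))
    have lift_b {Q : Over X} (x : Q ⟶ A) (y : Q ⟶ B) : lift x y ≫ b = y :=
      Over.OverMorphism.ext (h.lift_snd _ _ (w x y))
    exact ⟨BinaryFan.isLimitMk (fun s => lift s.fst s.snd) (fun s => lift_a s.fst s.snd)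
      (fun s => lift_b s.fst s.snd) fun s m h₁ h₂ => Over.OverMorphism.ext <| h.hom_ext
        (congr(($h₁).left).trans congr(($(lift_a s.fst s.snd)).left).symm)
        (congr(($h₂).left).trans congr(($(lift_b s.fst s.snd)).left).symm)⟩

variable {D : Type u₁} [Category.{v₁} D] {E : Type u₂} [Category.{v₂} E]

lemma frobeniusMap_fst [HasBinaryProducts D] [HasBinaryProducts E] {L : D ⥤ E} {R : E ⥤ D}
    (adj : L ⊣ R) (Y : E) (W : D) :
    frobeniusMap adj Y W ≫ prod.fst = L.map prod.fst ≫ adj.counit.app Y := by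
  rw [frobeniusMap, Category.assoc, prod.map_fst, prod.lift_fst_assoc]

lemma frobeniusMap_snd [HasBinaryProducts D] [HasBinaryProducts E] {L : D ⥤ E} {R : E ⥤ D}
    (adj : L ⊣ R) (Y : E) (W : D) :
    frobeniusMap adj Y W ≫ prod.snd = L.map prod.snd := by
  rw [frobeniusMap, Category.assoc, prod.map_snd, prod.lift_snd_assoc, Category.comp_id]

/-- An adjunction is stably Frobenius if and only if transposition preserves pullbacks along
morphisms in the image of the right adjoint. -/
lemma isStablyFrobenius_iff [HasFiniteLimits D] [HasFiniteLimits E] {L : D ⥤ E} {R : E ⥤ D}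
    (adj : L ⊣ R) :
    IsStablyFrobenius adj ↔ ∀ ⦃Y Z : E⦄ (f : Z ⟶ Y) ⦃V W : D⦄ (p : V ⟶ R.obj Z) (q : V ⟶ W)
      (g : W ⟶ R.obj Y), IsPullback p q (R.map f) g →
        IsPullback (L.map p ≫ adj.counit.app Z) (L.map q) f (L.map g ≫ adj.counit.app Y) := by
  constructor
  · intro h Y Z f V W p q g sq
    have hφ := h Y (Over.mk f) (Over.mk g)
    rw [← nonempty_isLimit_binaryFan_iff_isIso _ (frobeniusMap_fst _ _ _)
      (frobeniusMap_snd _ _ _), nonempty_isLimit_binaryFan_over_iff] at hφ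
    -- The given square makes `V` a product in `D / R Y`; the reciprocity map is stated for the
    -- chosen product, so the two are compared.
    let p' : Over.mk (q ≫ g) ⟶ (Over.post R).obj (Over.mk f) := Over.homMk p sq.w
    let q' : Over.mk (q ≫ g) ⟶ Over.mk g := Over.homMk q
    obtain ⟨l⟩ := (nonempty_isLimit_binaryFan_over_iff p' q').2 sq
    let e := l.conePointUniqueUpToIso (prodIsProd _ _)
    have e₁ : e.hom ≫ prod.fst = p' :=
      l.conePointUniqueUpToIso_hom_comp (prodIsProd _ _) ⟨WalkingPair.left⟩
    have e₂ : e.hom ≫ prod.snd = q' :=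
      l.conePointUniqueUpToIso_hom_comp (prodIsProd _ _) ⟨WalkingPair.right⟩
    have h₁ : L.map e.hom.left ≫ L.map (prod.fst : _ ⟶ (Over.post R).obj (Over.mk f)).left =
        L.map p := by
      rw [← L.map_comp]
      exact congr(L.map ($e₁).left)
    have h₂ : L.map e.hom.left ≫ L.map (prod.snd : _ ⟶ Over.mk g).left = L.map q := by
      rw [← L.map_comp]
      exact congr(L.map ($e₂).left)
    have sq' : IsPullback
        (L.map (prod.fst : _ ⟶ (Over.post R).obj (Over.mk f)).left ≫ adj.counit.app Z)
        (L.map (prod.snd : _ ⟶ Over.mk g).left) f (L.map g ≫ adj.counit.app Y) := hφ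
    have : IsIso (L.map e.hom.left) :=
      (L.mapIso ((Over.forget _).mapIso e)).isIso_hom
    exact sq'.of_isIso_comp (L.map e.hom.left)
      ((Category.assoc _ _ _).symm.trans congr($h₁ ≫ adj.counit.app Z)) h₂
  · intro h Y Z W
    rw [← nonempty_isLimit_binaryFan_iff_isIso _ (frobeniusMap_fst _ _ _)
      (frobeniusMap_snd _ _ _), nonempty_isLimit_binaryFan_over_iff]
    have sq := (nonempty_isLimit_binaryFan_over_iff _ _).1 ⟨prodIsProd ((Over.post R).obj Z) W⟩
    have := h Z.hom _ _ _ sq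
    exact this

lemma IsStablyFrobenius.comp {D' : Type*} [Category D'] [HasFiniteLimits D']
    [HasFiniteLimits D] [HasFiniteLimits E] {L : D ⥤ E} {R : E ⥤ D} {adj : L ⊣ R}
    {L' : D' ⥤ D} {R' : D ⥤ D'} {adj' : L' ⊣ R'}
    (h' : IsStablyFrobenius adj') (h : IsStablyFrobenius adj) :
    IsStablyFrobenius (adj'.comp adj) := by
  rw [isStablyFrobenius_iff] at *
  intro Y Z f V W p q g sq
  simpa using h f _ _ _ (h' (R.map f) _ _ _ sq)

lemma isStablyFrobenius_of_isEquivalence [HasFiniteLimits D] [HasFiniteLimits E]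
    {L : D ⥤ E} {R : E ⥤ D} (adj : L ⊣ R) [L.IsEquivalence] : IsStablyFrobenius adj := by
  have : R.IsEquivalence := adj.isEquivalence_right_of_isEquivalence_left
  rw [isStablyFrobenius_iff]
  intro Y Z f V W p q g sq
  refine (sq.map L).of_iso (Iso.refl _) (asIso (adj.counit.app Z)) (Iso.refl _)
      (asIso (adj.counit.app Y)) ?_ ?_ ?_ ?_ <;> simp

lemma isPullback_prod_map_id [HasBinaryProducts E] (P : E) {Y Z : E} (f : Z ⟶ Y) :
    IsPullback prod.snd (prod.map (𝟙 P) f) f prod.snd := by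
  refine ⟨⟨by rw [prod.map_snd]⟩, ⟨PullbackCone.IsLimit.mk _
    (fun s => prod.lift (s.snd ≫ prod.fst) s.fst) (fun s => prod.lift_snd _ _) (fun s => ?_)
    fun s m h₁ h₂ => ?_⟩⟩
  · apply prod.hom_ext
    · rw [Category.assoc, prod.map_fst, prod.lift_fst_assoc, Category.comp_id]
    · rw [Category.assoc, prod.map_snd, prod.lift_snd_assoc, s.condition]
  · apply prod.hom_ext
    · rw [prod.lift_fst, ← h₂, Category.assoc, prod.map_fst, Category.comp_id]
    · rw [prod.lift_snd, h₁]

/-- The counit is the projection `P × Y ⟶ Y`, and its naturality squares are pullbacks. Pasting such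
a square onto the given one gives the claim. -/
lemma isStablyFrobenius_forgetAdjStar [HasFiniteLimits E] (P : E) :
    IsStablyFrobenius (Over.forgetAdjStar P) := by
  rw [isStablyFrobenius_iff]
  intro Y Z f V W p q g sq
  have h' : IsPullback prod.snd ((Over.star P).map f).left f prod.snd :=
    Eq.subst (motive := fun m => IsPullback prod.snd m f prod.snd)
      (Over.star_map_left P f).symm (isPullback_prod_map_id P f)
  rw [Over.forgetAdjStar_counit_app, Over.forgetAdjStar_counit_app]
  exact ((sq.map (Over.forget P)).flip.paste_vert h'.flip).flip

end Frobenius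

/-! ### Split coequalizers of `G`-objects and free `G`-objects -/

section GObjects

variable {C : Type u} [Category.{v} C] [CartesianMonoidalCategory C] {G : C} [GrpObj G]

/-- The morphism of `G`-objects with a given equivariant underlying morphism. -/
def homMk {A B : GObj G} (f : A.X ⟶ B.X) (h : act A ≫ f = G ◁ f ≫ act B) : A ⟶ B :=
  Mod.Hom.mk' f h

/-- The isomorphism of `G`-objects with a given equivariant underlying isomorphism. -/
def isoMk {A B : GObj G} (e : A.X ≅ B.X) (h : act A ≫ e.hom = G ◁ e.hom ≫ act B) : A ≅ B where
  hom := homMk e.hom h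
  inv := homMk e.inv (by
    rw [Iso.comp_inv_eq, Category.assoc, h, ← MonoidalCategory.whiskerLeft_comp_assoc]
    simp)
  hom_inv_id := Mod.hom_ext _ _ e.hom_inv_id
  inv_hom_id := Mod.hom_ext _ _ e.inv_hom_id

instance : (Mod.forget (D := C) G).ReflectsIsomorphisms where
  reflects {A B} f hf := by
    have : IsIso f.hom := hf
    exact (isoMk (asIso f.hom) (act_hom f)).isIso_hom

instance : (Mod.forget (D := C) G).Faithful where
  map_injective h := Mod.hom_ext _ _ h

instance {J : Type u₁} [Category.{v₁} J] [HasLimitsOfShape J C] :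
    PreservesLimitsOfShape J (Mod.forget (D := C) G) where
  preservesLimit {F} := preservesLimit_of_preserves_limit_cone
    (limitGObjConeIsLimit F _ (limit.isLimit (F ⋙ Mod.forget G)))
    (IsLimit.ofIsoLimit (limit.isLimit (F ⋙ Mod.forget G)) (Cone.ext (Iso.refl _)
      fun _ => (Category.id_comp _).symm))

section Pullback

variable [HasFiniteLimits C] {P A B D : GObj G} {a : P ⟶ A} {b : P ⟶ B} {f : A ⟶ D} {g : B ⟶ D}

lemma isPullback_hom (h : IsPullback a b f g) : IsPullback a.hom b.hom f.hom g.hom :=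
  h.map (Mod.forget (D := C) G)

lemma isPullback_of_hom (h : IsPullback a.hom b.hom f.hom g.hom) : IsPullback a b f g :=
  have w : a ≫ f = b ≫ g := Mod.hom_ext _ _ h.w
  have : ReflectsLimit (cospan f g) (Mod.forget (D := C) G) :=
    reflectsLimit_of_reflectsIsomorphisms _ _
  IsPullback.of_map (Mod.forget (D := C) G) w h

end Pullback

section Coequalizer

variable {A B : GObj G} {a b : A ⟶ B} {Z : C} {π : B.X ⟶ Z}

/-- The action on a split coequalizer of `G`-objects. -/
def coequalizerAct (s : IsSplitCoequalizer a.hom b.hom π) : G ⊗ Z ⟶ Z :=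
  G ◁ s.rightSection ≫ act B ≫ π

/-- The right section need not be equivariant. However, `π` followed by it equals the left section
followed by `a`; equivariance of `a` and `b` and the coequalizer condition exchange `a` for `b`,
which the left section splits. -/
lemma whiskerLeft_coequalizerAct (s : IsSplitCoequalizer a.hom b.hom π) :
    G ◁ π ≫ coequalizerAct s = act B ≫ π := by
  rw [coequalizerAct, ← MonoidalCategory.whiskerLeft_comp_assoc, ← s.leftSection_top,
    MonoidalCategory.whiskerLeft_comp_assoc, ← reassoc_of% act_hom a, s.condition,
    reassoc_of% act_hom b, ← MonoidalCategory.whiskerLeft_comp_assoc, s.leftSection_bottom]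
  simp

/-- The split coequalizer of a pair of morphisms of `G`-objects, formed in `C`. -/
def coequalizerGObj (s : IsSplitCoequalizer a.hom b.hom π) : GObj G :=
  letI : ModObj G Z :=
    { smul := coequalizerAct s
      one_smul := by
        have : SplitEpi π := ⟨s.rightSection, s.rightSection_π⟩
        have : Epi π := this.epi
        -- The action laws hold after precomposing with the whiskered `π`, which the whiskered right
        -- section cancels.
        have h : 𝟙_ C ◁ π ≫ η[G] ▷ Z ≫ coequalizerAct s = 𝟙_ C ◁ π ≫ (λ_ Z).hom := by
          rw [whisker_exchange_assoc, whiskerLeft_coequalizerAct, reassoc_of% one_act B,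
            leftUnitor_naturality]
        have := congr(𝟙_ C ◁ s.rightSection ≫ $h)
        rwa [← MonoidalCategory.whiskerLeft_comp_assoc, ← MonoidalCategory.whiskerLeft_comp_assoc,
          s.rightSection_π, MonoidalCategory.whiskerLeft_id, Category.id_comp,
          Category.id_comp] at this
      mul_smul := by
        have h : (G ⊗ G) ◁ π ≫ μ[G] ▷ Z ≫ coequalizerAct s =
            (G ⊗ G) ◁ π ≫ (α_ G G Z).hom ≫ G ◁ coequalizerAct s ≫ coequalizerAct s := by
          rw [whisker_exchange_assoc, whiskerLeft_coequalizerAct, reassoc_of% mul_act B]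
          simp only [tensor_whiskerLeft, Category.assoc, Iso.inv_hom_id_assoc]
          rw [← MonoidalCategory.whiskerLeft_comp_assoc, whiskerLeft_coequalizerAct,
            MonoidalCategory.whiskerLeft_comp_assoc, whiskerLeft_coequalizerAct]
        have := congr((G ⊗ G) ◁ s.rightSection ≫ $h)
        rwa [← MonoidalCategory.whiskerLeft_comp_assoc, ← MonoidalCategory.whiskerLeft_comp_assoc,
          s.rightSection_π, MonoidalCategory.whiskerLeft_id, Category.id_comp,
          Category.id_comp] at this }
  ⟨Z⟩

/-- The projection to `coequalizerGObj`. -/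
def coequalizerGObjπ (s : IsSplitCoequalizer a.hom b.hom π) : B ⟶ coequalizerGObj s :=
  homMk (B := coequalizerGObj s) π (whiskerLeft_coequalizerAct s).symm

lemma coequalizerGObj_condition (s : IsSplitCoequalizer a.hom b.hom π) :
    a ≫ coequalizerGObjπ s = b ≫ coequalizerGObjπ s :=
  Mod.hom_ext _ _ s.condition

/-- `coequalizerGObj` is a coequalizer. -/
def coequalizerGObjIsColimit (s : IsSplitCoequalizer a.hom b.hom π) :
    IsColimit (Cofork.ofπ (coequalizerGObjπ s) (coequalizerGObj_condition s)) :=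
  Cofork.IsColimit.mk' _ fun c => by
    have hc : a.hom ≫ c.π.hom = b.hom ≫ c.π.hom := congr(($c.condition).hom)
    have hk : π ≫ s.rightSection ≫ c.π.hom = c.π.hom := by
      rw [← s.leftSection_top_assoc, hc, s.leftSection_bottom_assoc]
    have hact : coequalizerAct s ≫ s.rightSection ≫ c.π.hom =
        G ◁ (s.rightSection ≫ c.π.hom) ≫ act c.pt := by
      have h : G ◁ π ≫ coequalizerAct s ≫ s.rightSection ≫ c.π.hom =
          G ◁ π ≫ G ◁ (s.rightSection ≫ c.π.hom) ≫ act c.pt := by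
        rw [reassoc_of% whiskerLeft_coequalizerAct s, hk,
          ← MonoidalCategory.whiskerLeft_comp_assoc, hk]
        exact act_hom c.π
      have := congr(G ◁ s.rightSection ≫ $h)
      rwa [← MonoidalCategory.whiskerLeft_comp_assoc, ← MonoidalCategory.whiskerLeft_comp_assoc,
        s.rightSection_π, MonoidalCategory.whiskerLeft_id, Category.id_comp,
        Category.id_comp] at this
    have huniq (m : Z ⟶ c.pt.X) (hm : π ≫ m = c.π.hom) : m = s.rightSection ≫ c.π.hom := by
      rw [← hm, s.rightSection_π_assoc]
    exact ⟨homMk (A := coequalizerGObj s) (s.rightSection ≫ c.π.hom) hact,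
      Mod.hom_ext _ _ hk, fun {m} hm => Mod.hom_ext _ _ (huniq m.hom congr(($hm).hom))⟩

/-- The forgetful functor from `G`-objects creates coequalizers of split pairs. -/
@[reducible]
def createsColimitOfIsSplitPair (a b : A ⟶ B) [(Mod.forget (D := C) G).IsSplitPair a b] :
    CreatesColimit (parallelPair a b) (Mod.forget (D := C) G) := by
  let s : IsSplitCoequalizer a.hom b.hom _ :=
    HasSplitCoequalizer.isSplitCoequalizer ((Mod.forget (D := C) G).map a)
      ((Mod.forget (D := C) G).map b)
  have : HasColimit (parallelPair a b) := ⟨⟨_, coequalizerGObjIsColimit s⟩⟩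
  have : PreservesColimit (parallelPair a b) (Mod.forget (D := C) G) :=
    preservesColimit_of_preserves_colimit_cocone (coequalizerGObjIsColimit s)
      ((isColimitMapCoconeCoforkEquiv _ _).symm s.isCoequalizer)
  exact createsColimitOfReflectsIsomorphismsOfPreserves

end Coequalizer

section Free

/-- The free `G`-object on an object. -/
def freeGObj (G : C) [GrpObj G] (A : C) : GObj G :=
  letI : ModObj G (G ⊗ A) :=
    { smul := (α_ G G A).inv ≫ μ[G] ▷ A
      one_smul := by
        have : η[G] ▷ (G ⊗ A) ≫ (α_ G G A).inv ≫ μ[G] ▷ A = (λ_ (G ⊗ A)).hom := by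
          rw [← cancel_epi (α_ (𝟙_ C) G A).hom]
          simp [← comp_whiskerRight]
        exact this
      mul_smul := by
        have : μ[G] ▷ (G ⊗ A) ≫ (α_ G G A).inv ≫ μ[G] ▷ A = (α_ G G (G ⊗ A)).hom ≫
            G ◁ ((α_ G G A).inv ≫ μ[G] ▷ A) ≫ (α_ G G A).inv ≫ μ[G] ▷ A := by
          have h := congr($(MonObj.mul_assoc G) ▷ A)
          simp only [comp_whiskerRight] at h
          rw [← cancel_epi (α_ (G ⊗ G) G A).hom]
          simp [h]
        exact this }
  ⟨G ⊗ A⟩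

/-- The action of a `G`-object, as a morphism from the free `G`-object. -/
def freeAct (A : GObj G) : freeGObj G A.X ⟶ A :=
  homMk (A := freeGObj G A.X) (act A) (by
    have : ((α_ G G A.X).inv ≫ μ[G] ▷ A.X) ≫ act A = G ◁ act A ≫ act A := by
      rw [Category.assoc, mul_act, Iso.inv_hom_id_assoc]
    exact this)

/-- The projection from the free `G`-object to the trivial `G`-object. -/
def freeSnd (A : C) : freeGObj G A ⟶ (trivialFunctor G).obj A :=
  homMk (A := freeGObj G A) (B := trivialGObj G A) (snd G A) (by
    have : ((α_ G G A).inv ≫ μ[G] ▷ A) ≫ snd G A = G ◁ snd G A ≫ snd G A := by simp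
    exact this)

lemma act_comp_hom_trivial {A : GObj G} {B : C} (q : A ⟶ (trivialFunctor G).obj B) :
    act A ≫ q.hom = snd G A.X ≫ q.hom := by
  rw [act_hom]
  exact whiskerLeft_snd _ _

/-- Invariant morphisms correspond to morphisms into trivial `G`-objects. -/
def toTrivial {A : GObj G} {B : C} (q : A.X ⟶ B) (h : act A ≫ q = snd G A.X ≫ q) :
    A ⟶ (trivialFunctor G).obj B :=
  homMk (B := trivialGObj G B) q (h.trans (whiskerLeft_snd G q).symm)

variable {S : GObj G ⥤ C} (adj : S ⊣ trivialFunctor G)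

/-- In the free `G`-object, `(g, a) = g • (1, a)`, so an invariant `q` satisfies `q (g, a) = q (1,
a)`. -/
lemma snd_unit_comp_of_invariant {A Z : C} (q : G ⊗ A ⟶ Z)
    (h : ((α_ G G A).inv ≫ μ[G] ▷ A) ≫ q = snd G (G ⊗ A) ≫ q) :
    snd G A ≫ lift (toUnit A ≫ η[G]) (𝟙 A) ≫ q = q := by
  have h₁ : lift (fst G A) (snd G A ≫ lift (toUnit A ≫ η[G]) (𝟙 A)) ≫
      (α_ G G A).inv ≫ μ[G] ▷ A = 𝟙 (G ⊗ A) := by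
    have h₂ : lift (lift (fst G A) (toUnit _ ≫ η[G])) (snd G A) ≫ μ[G] ▷ A = 𝟙 (G ⊗ A) := by
      ext <;> simp
    rw [← h₂, ← Category.assoc]
    congr 1
    ext <;> simp
  have := congr(lift (fst G A) (snd G A ≫ lift (toUnit A ≫ η[G]) (𝟙 A)) ≫ $h)
  rw [← Category.assoc, h₁, Category.id_comp, lift_snd_assoc, Category.assoc] at this
  exact this.symm

/-- The orbit object of the free `G`-object on `A` is `A`; the inverse sends `a` to the orbit of
`(1, a)`. -/
lemma isIso_transpose_freeSnd (A : C) : IsIso ((adj.homEquiv _ _).symm (freeSnd (G := G) A)) := by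
  let u : freeGObj G A ⟶ (trivialFunctor G).obj (S.obj (freeGObj G A)) := adj.unit.app _
  let v : G ⊗ A ⟶ S.obj (freeGObj G A) := u.hom
  let t := (adj.homEquiv _ _).symm (freeSnd (G := G) A)
  have hv : snd G A ≫ lift (toUnit A ≫ η[G]) (𝟙 A) ≫ v = v :=
    snd_unit_comp_of_invariant v (act_comp_hom_trivial u)
  have ht : v ≫ t = snd G A := by
    have : u ≫ (trivialFunctor G).map t = freeSnd A :=
      (adj.homEquiv_unit _ _ _).symm.trans ((adj.homEquiv _ _).apply_symm_apply _)
    exact congr(($this).hom)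
  refine ⟨lift (toUnit A ≫ η[G]) (𝟙 A) ≫ v, ?_, ?_⟩
  · apply (adj.homEquiv _ _).injective
    rw [Adjunction.homEquiv_unit, Adjunction.homEquiv_id]
    have : v ≫ t ≫ lift (toUnit A ≫ η[G]) (𝟙 A) ≫ v = v := by rw [reassoc_of% ht, hv]
    exact Mod.hom_ext _ _ this
  · change (_ ≫ v) ≫ t = _
    rw [Category.assoc, ht, lift_snd]

end Free

end GObjects

/-! ### Reflections onto trivial `G`-objects -/

section Reflection

variable {C : Type u} [Category.{v} C] [CartesianMonoidalCategory C] {G : C} [GrpObj G]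
  {S : GObj G ⥤ C} (adj : S ⊣ trivialFunctor G)

/-- A morphism `A ⟶ G^* B` exhibits `B` as the value of the left adjoint of `G^*` at `A`. -/
def IsReflection {A : GObj G} {B : C} (q : A ⟶ (trivialFunctor G).obj B) : Prop :=
  IsIso ((adj.homEquiv A B).symm q)

namespace IsReflection

variable {adj} {A : GObj G} {B : C} {q : A ⟶ (trivialFunctor G).obj B}

lemma exists_eq (hq : IsReflection adj q) {Z : C} (v : A ⟶ (trivialFunctor G).obj Z) :
    ∃ n : B ⟶ Z, q ≫ (trivialFunctor G).map n = v := by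
  have : IsIso ((adj.homEquiv A B).symm q) := hq
  refine ⟨inv ((adj.homEquiv A B).symm q) ≫ (adj.homEquiv A Z).symm v, ?_⟩
  apply (adj.homEquiv _ _).symm.injective
  rw [Adjunction.homEquiv_naturality_right_symm, IsIso.hom_inv_id_assoc]

lemma hom_ext (hq : IsReflection adj q) {Z : C} {m n : B ⟶ Z}
    (h : q ≫ (trivialFunctor G).map m = q ≫ (trivialFunctor G).map n) : m = n := by
  have : IsIso ((adj.homEquiv A B).symm q) := hq
  have := congr((adj.homEquiv A Z).symm $h)
  rw [Adjunction.homEquiv_naturality_right_symm, Adjunction.homEquiv_naturality_right_symm] at this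
  exact (cancel_epi _).1 this

lemma isIso (hq : IsReflection adj q) {Z : C} {n : B ⟶ Z}
    (hn : IsReflection adj (q ≫ (trivialFunctor G).map n)) : IsIso n := by
  have : IsIso ((adj.homEquiv A B).symm q) := hq
  have : IsIso ((adj.homEquiv A B).symm q ≫ n) := by
    rw [← Adjunction.homEquiv_naturality_right_symm]
    exact hn
  exact IsIso.of_isIso_comp_left ((adj.homEquiv A B).symm q) n

lemma iso_comp (hq : IsReflection adj q) {A' : GObj G} (i : A' ⟶ A) [IsIso i] :
    IsReflection adj (i ≫ q) := by
  have : IsIso ((adj.homEquiv A B).symm q) := hq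
  rw [IsReflection, Adjunction.homEquiv_naturality_left_symm]
  infer_instance

end IsReflection

end Reflection

section Top

variable {C : Type u} [Category.{v} C] {X : C}

/-- The morphism from an object of `C / X` to the terminal object. -/
def toTop (W : Over X) : W ⟶ Over.mk (𝟙 X) := Over.homMk W.hom

lemma comp_toTop {V W : Over X} (m : V ⟶ W) : m ≫ toTop W = toTop V :=
  Over.mkIdTerminal.hom_ext _ _

end Top

/-! ### From adjunctions to bundles: the slice over `L 1` and the shear isomorphism -/

namespace StablyFrobeniusAdjunctionOver

variable {C : Type u} [Category.{v} C] [CartesianMonoidalCategory C] [HasFiniteLimits C]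
  {G : C} [GrpObj G] {S : GObj G ⥤ C} {X : C} (A : StablyFrobeniusAdjunctionOver S X)

instance : A.L.ReflectsIsomorphisms :=
  have : (A.L ⋙ S).ReflectsIsomorphisms := reflectsIsomorphisms_of_iso A.overIso.symm
  reflectsIsomorphisms_of_comp A.L S

instance : A.L.Faithful := Functor.Faithful.of_comp_iso A.overIso

/-- `V` is the pullback of `R u` along the unit at `1`. Stable Frobenius reciprocity carries this
square to a pullback of `u` along the transpose of the unit, which is an identity by a triangle
identity; the other leg is therefore invertible. -/
lemma exists_iso_of_hom {T : GObj G} (u : T ⟶ A.L.obj (Over.mk (𝟙 X))) :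
    ∃ (V : Over X) (p : V ⟶ A.R.obj T), IsPullback p (toTop V) (A.R.map u) (A.adj.unit.app _) ∧
      IsIso (A.L.map p ≫ A.adj.counit.app T) ∧
      (A.L.map p ≫ A.adj.counit.app T) ≫ u = A.L.map (toTop V) := by
  have sq := IsPullback.of_hasPullback (A.R.map u) (A.adj.unit.app (Over.mk (𝟙 X)))
  have hq : pullback.snd (A.R.map u) (A.adj.unit.app (Over.mk (𝟙 X))) = toTop _ :=
    Over.mkIdTerminal.hom_ext _ _
  rw [hq] at sq
  have sq' := (isStablyFrobenius_iff A.adj).1 A.stablyFrobenius u _ _ _ sq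
  have sq'' : IsPullback _ _ u (𝟙 (A.L.obj (Over.mk (𝟙 X)))) :=
    Eq.subst (A.adj.left_triangle_components (Over.mk (𝟙 X))) sq'
  exact ⟨_, _, sq, sq''.isIso_fst_of_isIso, sq''.w.trans (Category.comp_id _)⟩

lemma exists_isIso_comp_eq {T : GObj G} (u : T ⟶ A.L.obj (Over.mk (𝟙 X))) :
    ∃ (V : Over X) (i : A.L.obj V ⟶ T), IsIso i ∧ i ≫ u = A.L.map (toTop V) := by
  obtain ⟨V, p, -, hi, hiu⟩ := A.exists_iso_of_hom u
  exact ⟨V, _, hi, hiu⟩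

/-- `W` is compared with the pullback `V` obtained from `L W ⟶ L 1`. By a triangle identity, `L` of
the comparison followed by an isomorphism is the identity, and `L` reflects isomorphisms. -/
lemma isPullback_unit (W : Over X) : IsPullback (A.adj.unit.app W) (toTop W)
    (A.R.map (A.L.map (toTop W))) (A.adj.unit.app _) := by
  obtain ⟨V, p, sq, hp, -⟩ := A.exists_iso_of_hom (A.L.map (toTop W))
  have h₁ : sq.lift (A.adj.unit.app W) (toTop W) (A.adj.unit_naturality _) ≫ p =
    A.adj.unit.app W := sq.lift_fst _ _ _
  have : IsIso (sq.lift (A.adj.unit.app W) (toTop W) (A.adj.unit_naturality _)) := by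
    have : IsIso (A.L.map (sq.lift (A.adj.unit.app W) (toTop W)
        (A.adj.unit_naturality _))) := by
      have h₂ : A.L.map (sq.lift (A.adj.unit.app W) (toTop W) (A.adj.unit_naturality _)) ≫
          A.L.map p ≫ A.adj.counit.app _ = 𝟙 _ := by
        rw [← A.L.map_comp_assoc, h₁]
        exact A.adj.left_triangle_components W
      exact IsIso.of_isIso_fac_right h₂
    exact isIso_of_reflects_iso _ A.L
  exact sq.of_isIso_comp _ h₁ (comp_toTop _)

/-- Fullness of `L` over `L 1`: the transpose of `h` lifts through the pullback square of the unit.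
-/
lemma exists_map_eq {V W : Over X} (h : A.L.obj V ⟶ A.L.obj W)
    (w : h ≫ A.L.map (toTop W) = A.L.map (toTop V)) : ∃ m : V ⟶ W, A.L.map m = h := by
  have w' : A.adj.homEquiv _ _ h ≫ A.R.map (A.L.map (toTop W)) =
      toTop V ≫ A.adj.unit.app (Over.mk (𝟙 X)) := by
    rw [← Adjunction.homEquiv_naturality_right, w, Adjunction.homEquiv_unit]
    exact (A.adj.unit_naturality _)
  refine ⟨(A.isPullback_unit W).lift _ _ w', ?_⟩
  apply (A.adj.homEquiv _ _).injective
  refine Eq.trans ?_ ((A.isPullback_unit W).lift_fst _ _ w')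
  rw [Adjunction.homEquiv_unit]
  exact A.adj.unit_naturality _

/-- The isomorphism over `C` at an object. -/
def base (W : Over X) : S.obj (A.L.obj W) ⟶ W.left := A.overIso.hom.app W

instance (W : Over X) : IsIso (A.base W) := inferInstanceAs (IsIso (A.overIso.hom.app W))

lemma base_naturality {V W : Over X} (m : V ⟶ W) :
    S.map (A.L.map m) ≫ A.base W = A.base V ≫ m.left :=
  A.overIso.hom.naturality m

variable (adj : S ⊣ trivialFunctor G)

/-- The reflection of `L W` onto a trivial `G`-object, given by the isomorphism over `C`. -/
def toBase (W : Over X) : A.L.obj W ⟶ (trivialFunctor G).obj W.left :=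
  adj.homEquiv _ _ (A.base W)

lemma isReflection_toBase (W : Over X) : IsReflection adj (A.toBase adj W) := by
  rw [IsReflection, toBase, Equiv.symm_apply_apply]
  infer_instance

lemma toBase_naturality {V W : Over X} (m : V ⟶ W) :
    A.L.map m ≫ A.toBase adj W = A.toBase adj V ≫ (trivialFunctor G).map m.left := by
  rw [toBase, toBase, ← Adjunction.homEquiv_naturality_left,
    ← Adjunction.homEquiv_naturality_right, base_naturality]

/-- A test object over `L 1` may be taken to be `L V`. A morphism from it to `G^* W` then factors
through the reflection as a morphism `V ⟶ W` over `X`, to which `L` is applied. Uniqueness holds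
because morphisms `L V ⟶ L W` over `L 1` come from `V ⟶ W`, which the reflection detects. -/
lemma isPullback_toBase (W : Over X) : IsPullback (A.L.map (toTop W)) (A.toBase adj W)
    (A.toBase adj (Over.mk (𝟙 X))) ((trivialFunctor G).map W.hom) := by
  have w := A.toBase_naturality adj (toTop W)
  have hlift (T : GObj G) (u : T ⟶ A.L.obj (Over.mk (𝟙 X)))
      (v : T ⟶ (trivialFunctor G).obj W.left)
      (huv : u ≫ A.toBase adj (Over.mk (𝟙 X)) = v ≫ (trivialFunctor G).map W.hom) :
      ∃ l : T ⟶ A.L.obj W, l ≫ A.L.map (toTop W) = u ∧ l ≫ A.toBase adj W = v := by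
    obtain ⟨V, i, hi, hiu⟩ := A.exists_isIso_comp_eq u
    obtain ⟨n, hn⟩ := (A.isReflection_toBase adj V).exists_eq (i ≫ v)
    have hnW : n ≫ W.hom = V.hom := by
      apply (A.isReflection_toBase adj V).hom_ext
      rw [Functor.map_comp, reassoc_of% hn, ← huv, reassoc_of% hiu]
      exact A.toBase_naturality adj (toTop V)
    refine ⟨inv i ≫ A.L.map (Over.homMk n hnW), ?_, ?_⟩
    · rw [Category.assoc, ← A.L.map_comp, comp_toTop, IsIso.inv_comp_eq, hiu]
    · rw [Category.assoc, A.toBase_naturality adj, IsIso.inv_comp_eq]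
      exact hn
  have huniq (T : GObj G) (l l' : T ⟶ A.L.obj W)
      (h₁ : l ≫ A.L.map (toTop W) = l' ≫ A.L.map (toTop W))
      (h₂ : l ≫ A.toBase adj W = l' ≫ A.toBase adj W) : l = l' := by
    obtain ⟨V, i, hi, hiu⟩ := A.exists_isIso_comp_eq (l ≫ A.L.map (toTop W))
    obtain ⟨m, hm⟩ := A.exists_map_eq (i ≫ l) (by rw [Category.assoc, hiu])
    obtain ⟨m', hm'⟩ := A.exists_map_eq (i ≫ l') (by rw [Category.assoc, ← h₁, hiu])
    have : m = m' := by
      ext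
      apply (A.isReflection_toBase adj V).hom_ext
      rw [← toBase_naturality, ← toBase_naturality, hm, hm', Category.assoc, h₂,
        Category.assoc]
    rw [← cancel_epi i, ← hm, ← hm', this]
  choose lift hlift₁ hlift₂ using hlift
  exact ⟨⟨w⟩, ⟨PullbackCone.IsLimit.mk _ (fun s => lift _ s.fst s.snd s.condition)
    (fun s => hlift₁ _ _ _ _) (fun s => hlift₂ _ _ _ _)
    fun s m h₁ h₂ => huniq _ _ _ (h₁.trans (hlift₁ _ _ _ _).symm)
      (h₂.trans (hlift₂ _ _ _ _).symm)⟩⟩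

/-- Up to isomorphism `u` is `L` of some `V ⟶ 1`, and reflections are unique up to isomorphism, so
the square is that of `isPullback_toBase`. -/
lemma isPullback_of_isReflection {T : GObj G} {B : C} (u : T ⟶ A.L.obj (Over.mk (𝟙 X)))
    {q : T ⟶ (trivialFunctor G).obj B} (hq : IsReflection adj q) (z : B ⟶ X)
    (w : u ≫ A.toBase adj (Over.mk (𝟙 X)) = q ≫ (trivialFunctor G).map z) :
    IsPullback u q (A.toBase adj (Over.mk (𝟙 X))) ((trivialFunctor G).map z) := by
  obtain ⟨V, i, hi, hiu⟩ := A.exists_isIso_comp_eq u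
  obtain ⟨n, hn⟩ := (A.isReflection_toBase adj V).exists_eq (i ≫ q)
  have : IsIso n := (A.isReflection_toBase adj V).isIso (hn ▸ hq.iso_comp i)
  have hnz : n ≫ z = V.hom := by
    apply (A.isReflection_toBase adj V).hom_ext
    rw [Functor.map_comp, reassoc_of% hn, ← w, reassoc_of% hiu]
    exact A.toBase_naturality adj (toTop V)
  refine (A.isPullback_toBase adj V).of_iso (asIso i) (Iso.refl _)
    (asIso ((trivialFunctor G).map n)) (Iso.refl _) ?_ ?_ ?_ ?_
  · rw [Iso.refl_hom, Category.comp_id]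
    exact hiu.symm
  · exact hn
  · simp
  · rw [asIso_hom, Iso.refl_hom, Category.comp_id, ← Functor.map_comp, hnz]

/-- The projection of the bundle associated to an adjunction. -/
def proj : (A.L.obj (Over.mk (𝟙 X))).X ⟶ X := (A.toBase adj (Over.mk (𝟙 X))).hom

lemma act_proj : act (A.L.obj (Over.mk (𝟙 X))) ≫ A.proj adj = snd G _ ≫ A.proj adj :=
  act_comp_hom_trivial _

/-- The action is a morphism of `G`-objects from the free one on `L 1`, and the projection is the
reflection of that free object. -/
lemma isPullback_shear : IsPullback (act (A.L.obj (Over.mk (𝟙 X)))) (snd G _)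
    (A.proj adj) (A.proj adj) :=
  isPullback_hom (A.isPullback_of_isReflection adj (freeAct _)
    (isIso_transpose_freeSnd adj _ : IsReflection adj (freeSnd _)) (A.proj adj)
    (Mod.hom_ext _ _ (A.act_proj adj)))

/-- The underlying morphism of `toBase`. -/
def baseProj (W : Over X) : (A.L.obj W).X ⟶ W.left := (A.toBase adj W).hom

lemma isPullback_proj (W : Over X) :
    IsPullback (A.L.map (toTop W)).hom (A.baseProj adj W) (A.proj adj) W.hom :=
  isPullback_hom (A.isPullback_toBase adj W)

end StablyFrobeniusAdjunctionOver

lemma hasSplitCoequalizer_of_natIso {D : Type u₁} [Category.{v₁} D] {E : Type u₂} [Category.{v₂} E]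
    {F H : D ⥤ E} (φ : F ≅ H) {V W : D} (a b : V ⟶ W) [F.IsSplitPair a b] : H.IsSplitPair a b := by
  obtain ⟨Z, π, ⟨s⟩⟩ := HasSplitCoequalizer.splittable (f := F.map a) (g := F.map b)
  exact ⟨Z, φ.inv.app W ≫ π, ⟨{
    rightSection := s.rightSection ≫ φ.hom.app W
    leftSection := φ.inv.app W ≫ s.leftSection ≫ φ.hom.app V
    condition := by
      rw [φ.inv.naturality_assoc, φ.inv.naturality_assoc, s.condition]
    rightSection_π := by simp
    leftSection_bottom := by
      rw [Category.assoc, Category.assoc, ← φ.hom.naturality, s.leftSection_bottom_assoc]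
      simp
    leftSection_top := by
      rw [Category.assoc, Category.assoc, ← φ.hom.naturality, s.leftSection_top_assoc]
      simp }⟩⟩

lemma _root_.CategoryTheory.IsPullback.isoPullback_naturality {C : Type u} [Category.{v} C]
    [HasPullbacks C] {X P V W T T' : C} {f : P ⟶ X} {a : V ⟶ X} {b : W ⟶ X} {m : V ⟶ W}
    {p : T ⟶ V} {q : T ⟶ P} {p' : T' ⟶ W} {q' : T' ⟶ P} (sq : IsPullback p q a f)
    (sq' : IsPullback p' q' b f) {k : T ⟶ T'} (hp : k ≫ p' = p ≫ m) (hq : k ≫ q' = q)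
    {w : (pullback.fst a f ≫ m) ≫ b = pullback.snd a f ≫ f} :
    k ≫ sq'.isoPullback.hom = sq.isoPullback.hom ≫
      pullback.lift (pullback.fst a f ≫ m) (pullback.snd a f) w := by
  apply pullback.hom_ext
  · rw [Category.assoc, Category.assoc, pullback.lift_fst, IsPullback.isoPullback_hom_fst, hp,
      IsPullback.isoPullback_hom_fst_assoc]
  · rw [Category.assoc, Category.assoc, pullback.lift_snd, IsPullback.isoPullback_hom_snd, hq,
      IsPullback.isoPullback_hom_snd]

/-! ### Effective descent, and full faithfulness on morphisms -/

namespace StablyFrobeniusAdjunctionOver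

variable {C : Type u} [Category.{v} C] [CartesianMonoidalCategory C] [HasFiniteLimits C]
  {G : C} [GrpObj G] {S : GObj G ⥤ C} {X : C} (A : StablyFrobeniusAdjunctionOver S X)

/-- The left adjoint, with values in the slice over its value at the terminal object. -/
def toOverTop : Over X ⥤ Over (A.L.obj (Over.mk (𝟙 X))) where
  obj W := Over.mk (A.L.map (toTop W))
  map m := Over.homMk (A.L.map m) (by
    change _ ≫ A.L.map (toTop _) = A.L.map (toTop _)
    rw [← A.L.map_comp, comp_toTop])

/-- Forgetting the structure morphism of `toOverTop` recovers the left adjoint. -/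
def toOverTopForget : A.toOverTop ⋙ Over.forget _ ≅ A.L :=
  NatIso.ofComponents (fun _ => Iso.refl _)
    fun m => (Category.comp_id (A.L.map m)).trans (Category.id_comp (A.L.map m)).symm

/-- Thus `L` is an equivalence followed by the forgetful functor of a slice, from which it inherits
creation of colimits. -/
instance : A.toOverTop.IsEquivalence where
  faithful := ⟨fun h => A.L.map_injective congr(($h).left)⟩
  full := ⟨fun h => by
    obtain ⟨m, hm⟩ := A.exists_map_eq h.left (Over.w h)
    exact ⟨m, Over.OverMorphism.ext hm⟩⟩
  essSurj := ⟨fun T => by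
    obtain ⟨V, i, hi, hiu⟩ := A.exists_isIso_comp_eq T.hom
    exact ⟨V, ⟨Over.isoMk (@asIso _ _ _ _ i hi) hiu⟩⟩⟩

/-- The left adjoint creates colimits. -/
@[reducible]
def createsColimitL {J : Type} [Category.{0} J] (K : J ⥤ Over X) : CreatesColimit K A.L :=
  createsColimitOfNatIso A.toOverTopForget

variable (adj : S ⊣ trivialFunctor G)

/-- Pullback along the bundle projection is the left adjoint, followed by the forgetful functor. -/
def forgetIsoPullback : A.L ⋙ Mod.forget (D := C) G ≅
    Over.pullback (A.proj adj) ⋙ Over.forget _ :=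
  NatIso.ofComponents (fun W => (A.isPullback_proj adj W).flip.isoPullback) (fun {V W} m => by
    refine (A.isPullback_proj adj V).flip.isoPullback_naturality (A.isPullback_proj adj W).flip
      congr(($(A.toBase_naturality adj m)).hom) ?_
    rw [← Mod.comp_hom', ← A.L.map_comp, comp_toTop])

/-- Beck's theorem. A pair split by `f^*` is sent by `L` to a pair split by the forgetful functor to
`C`. That functor creates its coequalizer, and so does `L`; the result transfers to `f^*` because
`Over.forget` reflects colimits. -/
lemma isEffectiveDescent_proj : IsEffectiveDescent (A.proj adj) := by
  have : (Over.pullback (A.proj adj)).ReflectsIsomorphisms :=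
    have : (Over.pullback (A.proj adj) ⋙ Over.forget _).ReflectsIsomorphisms :=
      reflectsIsomorphisms_of_iso (A.forgetIsoPullback adj)
    reflectsIsomorphisms_of_comp _ (Over.forget _)
  have key {V W : Over X} (a b : V ⟶ W) [(Over.pullback (A.proj adj)).IsSplitPair a b] :
      HasCoequalizer a b ∧ PreservesColimit (parallelPair a b) (Over.pullback (A.proj adj)) := by
    have : (Over.pullback (A.proj adj) ⋙ Over.forget _).IsSplitPair a b :=
      map_is_split_pair (Over.forget _) ((Over.pullback (A.proj adj)).map a)
        ((Over.pullback (A.proj adj)).map b)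
    have : (A.L ⋙ Mod.forget (D := C) G).IsSplitPair a b :=
      hasSplitCoequalizer_of_natIso (A.forgetIsoPullback adj).symm a b
    have : (Mod.forget (D := C) G).IsSplitPair (A.L.map a) (A.L.map b) := this
    let _ := createsColimitOfIsSplitPair (A.L.map a) (A.L.map b)
    let e : parallelPair (A.L.map a) (A.L.map b) ≅ parallelPair a b ⋙ A.L :=
      (diagramIsoParallelPair (parallelPair a b ⋙ A.L)).symm
    let _ : CreatesColimit (parallelPair a b ⋙ A.L) (Mod.forget (D := C) G) :=
      createsColimitOfIsoDiagram _ e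
    let _ := A.createsColimitL (parallelPair a b)
    let _ : CreatesColimit (parallelPair a b) (A.L ⋙ Mod.forget (D := C) G) :=
      compCreatesColimit _ _
    let _ : CreatesColimit (parallelPair a b) (Over.pullback (A.proj adj) ⋙ Over.forget _) :=
      createsColimitOfNatIso (A.forgetIsoPullback adj)
    have : HasColimit (parallelPair a b ⋙ Over.pullback (A.proj adj) ⋙ Over.forget _) := by
      rw [hasColimit_iff_of_iso (diagramIsoParallelPair _)]
      exact inferInstanceAs (HasCoequalizer
        ((Over.pullback (A.proj adj) ⋙ Over.forget _).map a)
        ((Over.pullback (A.proj adj) ⋙ Over.forget _).map b))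
    have : HasColimit (parallelPair a b) :=
      hasColimit_of_created _ (Over.pullback (A.proj adj) ⋙ Over.forget _)
    exact ⟨this, preservesColimit_of_reflects_of_preserves _ (Over.forget _)⟩
  have : Monad.HasCoequalizerOfIsSplitPair (Over.pullback (A.proj adj)) :=
    ⟨fun a b _ => (key a b).1⟩
  have : Monad.PreservesColimitOfIsSplitPair (Over.pullback (A.proj adj)) :=
    ⟨fun a b _ => (key a b).2⟩
  exact ⟨Monad.monadicOfHasPreservesGSplitCoequalizersOfReflectsIsomorphisms
    (Over.mapPullbackAdj (A.proj adj))⟩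

/-- The principal bundle associated to a stably Frobenius adjunction over `C`. -/
def toPrincipalBundle : PrincipalBundle G X where
  P := A.L.obj (Over.mk (𝟙 X))
  f := A.proj adj
  smul_f := A.act_proj adj
  effectiveDescent := A.isEffectiveDescent_proj adj
  isIso_shear := by
    have h := A.isPullback_shear adj
    have : pullback.lift (act (A.L.obj (Over.mk (𝟙 X)))) (snd G _) (A.act_proj adj) =
        h.isoPullback.hom := by
      apply pullback.hom_ext
      · rw [pullback.lift_fst, IsPullback.isoPullback_hom_fst]
      · rw [pullback.lift_snd, IsPullback.isoPullback_hom_snd]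
    rw [this]
    infer_instance

lemma Hom.toBase_comp {A B : StablyFrobeniusAdjunctionOver S X} (τ : A ⟶ B) (W : Over X) :
    τ.τ.app W ≫ B.toBase adj W = A.toBase adj W := by
  have : S.map (τ.τ.app W) ≫ B.base W = A.base W := congr(($(τ.w)).app W)
  rw [toBase, toBase, ← Adjunction.homEquiv_naturality_left, this]

/-- The functor sending a stably Frobenius adjunction over `C` to its principal bundle. -/
def toPrincipalBundleFunctor : StablyFrobeniusAdjunctionOver S X ⥤ PrincipalBundle G X where
  obj A := A.toPrincipalBundle adj
  map τ :=
    { hom := τ.τ.app (Over.mk (𝟙 X))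
      w := congr(($(Hom.toBase_comp adj τ (Over.mk (𝟙 X)))).hom) }
  map_id _ := rfl
  map_comp _ _ := rfl

lemma Hom.app_comp_map_toTop {A B : StablyFrobeniusAdjunctionOver S X} (τ : A.L ⟶ B.L)
    (W : Over X) : τ.app W ≫ B.L.map (toTop W) = A.L.map (toTop W) ≫ τ.app (Over.mk (𝟙 X)) :=
  (τ.naturality (toTop W)).symm

/-- By `isPullback_toBase`, the component at `W` is determined by the one at `1` and by
compatibility with the reflections, which is the condition of being over `C`. -/
instance : (toPrincipalBundleFunctor (X := X) adj).Faithful where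
  map_injective {A B} τ τ' h := by
    have h' : τ.τ.app (Over.mk (𝟙 X)) = τ'.τ.app (Over.mk (𝟙 X)) :=
      congr(PrincipalBundle.Hom.hom $h)
    refine Hom.ext (NatTrans.ext (funext fun W => (B.isPullback_toBase adj W).hom_ext ?_ ?_))
    · rw [Hom.app_comp_map_toTop, Hom.app_comp_map_toTop, h']
    · rw [Hom.toBase_comp, Hom.toBase_comp]

instance : (toPrincipalBundleFunctor (X := X) adj).Full where
  map_surjective {A B} k := by
    let h : A.L.obj (Over.mk (𝟙 X)) ⟶ B.L.obj (Over.mk (𝟙 X)) := k.hom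
    have hk : h ≫ B.toBase adj (Over.mk (𝟙 X)) = A.toBase adj (Over.mk (𝟙 X)) :=
      Mod.hom_ext _ _ k.w
    have w (W : Over X) : (A.L.map (toTop W) ≫ h) ≫ B.toBase adj (Over.mk (𝟙 X)) =
        A.toBase adj W ≫ (trivialFunctor G).map W.hom := by
      rw [Category.assoc, hk]
      exact A.toBase_naturality adj (toTop W)
    -- The component at `W` is forced: it is the base change of `h` along `W ⟶ X`.
    let t (W : Over X) : A.L.obj W ⟶ B.L.obj W := (B.isPullback_toBase adj W).lift _ _ (w W)
    have ht₁ (W : Over X) : t W ≫ B.L.map (toTop W) = A.L.map (toTop W) ≫ h :=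
      (B.isPullback_toBase adj W).lift_fst _ _ _
    have ht₂ (W : Over X) : t W ≫ B.toBase adj W = A.toBase adj W :=
      (B.isPullback_toBase adj W).lift_snd _ _ _
    let τ : A.L ⟶ B.L :=
      { app := t
        naturality := fun V W m => by
          apply (B.isPullback_toBase adj W).hom_ext
          · rw [Category.assoc, Category.assoc, ht₁, ← B.L.map_comp, comp_toTop, ht₁,
              ← A.L.map_comp_assoc, comp_toTop]
          · rw [Category.assoc, Category.assoc, ht₂, toBase_naturality, toBase_naturality,
              reassoc_of% ht₂ V] }
    have hτ : Functor.whiskerRight τ S ≫ B.overIso.hom = A.overIso.hom := by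
      ext W
      have : S.map (t W) ≫ B.base W = A.base W := by
        apply (adj.homEquiv _ _).injective
        rw [Adjunction.homEquiv_naturality_left]
        exact ht₂ W
      exact this
    refine ⟨⟨τ, hτ⟩, PrincipalBundle.Hom.ext ?_⟩
    have : toTop (Over.mk (𝟙 X)) = 𝟙 _ := Over.mkIdTerminal.hom_ext _ _
    have h₁ := ht₁ (Over.mk (𝟙 X))
    rw [this, A.L.map_id, B.L.map_id, Category.comp_id, Category.id_comp] at h₁
    exact h₁

end StablyFrobeniusAdjunctionOver

/-! ### Descent along a principal bundle -/

namespace PrincipalBundle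

variable {C : Type u} [Category.{v} C] [CartesianMonoidalCategory C] [HasFiniteLimits C]
  {G : C} [GrpObj G] {X : C} (B : PrincipalBundle G X)

lemma smul_comp_f {Z : C} (g : Z ⟶ G) (p : Z ⟶ B.P.X) : (g • p) ≫ B.f = p ≫ B.f := by
  have : lift g p ≫ act B.P ≫ B.f = lift g p ≫ snd G B.P.X ≫ B.f := by rw [B.smul_f]
  rw [lift_snd_assoc] at this
  rw [Hom.smul_def, Category.assoc]
  exact this

lemma isPullback_shear : IsPullback (act B.P) (snd G B.P.X) B.f B.f := by
  have := B.isIso_shear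
  exact (IsPullback.of_hasPullback B.f B.f).of_isIso_comp
    (pullback.lift (act B.P) (snd G B.P.X) B.smul_f) (pullback.lift_fst _ _ _)
    (pullback.lift_snd _ _ _)

/-- The unique element of `G` carrying one point of a fibre to another. -/
def div {Z : C} (x y : Z ⟶ B.P.X) (h : x ≫ B.f = y ≫ B.f) : Z ⟶ G :=
  B.isPullback_shear.lift x y h ≫ fst G B.P.X

lemma div_smul {Z : C} (x y : Z ⟶ B.P.X) (h : x ≫ B.f = y ≫ B.f) : B.div x y h • y = x := by
  have h₁ := B.isPullback_shear.lift_fst x y h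
  have h₂ := B.isPullback_shear.lift_snd x y h
  have : lift (B.div x y h) y = B.isPullback_shear.lift x y h := by
    rw [div]
    ext
    · simp
    · rw [lift_snd, h₂]
  rw [Hom.smul_def, this]
  exact h₁

lemma smul_left_injective {Z : C} {g g' : Z ⟶ G} {y : Z ⟶ B.P.X} (h : g • y = g' • y) :
    g = g' := by
  have : lift g y = lift g' y := B.isPullback_shear.hom_ext h (by simp)
  simpa using congr($this ≫ fst _ _)

lemma comp_div {Z Z' : C} (k : Z' ⟶ Z) (x y : Z ⟶ B.P.X) (h : x ≫ B.f = y ≫ B.f) :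
    k ≫ B.div x y h = B.div (k ≫ x) (k ≫ y) (by rw [Category.assoc, h, Category.assoc]) := by
  apply B.smul_left_injective (y := k ≫ y)
  rw [div_smul, ← ModObj.comp_smul, div_smul]

lemma div_smul_right {Z : C} (x y : Z ⟶ B.P.X) (g : Z ⟶ G) (h : x ≫ B.f = (g • y) ≫ B.f)
    (h' : x ≫ B.f = y ≫ B.f) : B.div x (g • y) h * g = B.div x y h' := by
  apply B.smul_left_injective (y := y)
  rw [mul_smul, div_smul, div_smul]

section Descent

variable {T : GObj G} (h : T ⟶ B.P)

/-- The action of the group on an object over the bundle, in the slice over the base. -/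
def actOver : (Over.mk (snd G T.X ≫ h.hom ≫ B.f) : Over X) ⟶ Over.mk (h.hom ≫ B.f) :=
  Over.homMk (act T) (by
    change act T ≫ h.hom ≫ B.f = _
    rw [← Category.assoc, act_hom, Category.assoc, B.smul_f]
    simp)

/-- The projection, in the slice over the base. -/
def sndOver : (Over.mk (snd G T.X ≫ h.hom ≫ B.f) : Over X) ⟶ Over.mk (h.hom ≫ B.f) :=
  Over.homMk (snd G T.X)

lemma translation_condition : pullback.snd (h.hom ≫ B.f) B.f ≫ B.f =
    (pullback.fst (h.hom ≫ B.f) B.f ≫ h.hom) ≫ B.f := by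
  rw [← pullback.condition, Category.assoc]

/-- `(a, p) ↦ (p / a) • a`. -/
def translate : pullback (h.hom ≫ B.f) B.f ⟶ T.X :=
  B.div (pullback.snd (h.hom ≫ B.f) B.f) (pullback.fst (h.hom ≫ B.f) B.f ≫ h.hom)
    (B.translation_condition h) • pullback.fst (h.hom ≫ B.f) B.f

lemma comp_translate {Z : C} (k : Z ⟶ pullback (h.hom ≫ B.f) B.f) {a : Z ⟶ T.X} {p : Z ⟶ B.P.X}
    (ha : k ≫ pullback.fst _ _ = a) (hp : k ≫ pullback.snd _ _ = p)
    (w : p ≫ B.f = (a ≫ h.hom) ≫ B.f) :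
    k ≫ B.translate h = B.div p (a ≫ h.hom) w • a := by
  subst ha hp
  rw [translate, ModObj.comp_smul]
  congr 1
  rw [comp_div]
  congr 1
  rw [Category.assoc]

lemma translate_comp : B.translate h ≫ h.hom = pullback.snd _ _ := by
  rw [translate, IsModHom.map_smul, div_smul]

/-- `a ↦ (a, h a)`. -/
def graph : T.X ⟶ pullback (h.hom ≫ B.f) B.f :=
  pullback.lift (𝟙 T.X) h.hom (Category.id_comp _)

lemma graph_translate : B.graph h ≫ B.translate h = 𝟙 _ := by
  have w : h.hom ≫ B.f = (𝟙 _ ≫ h.hom) ≫ B.f := by rw [Category.id_comp]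
  rw [B.comp_translate h (B.graph h) (pullback.lift_fst _ _ _) (pullback.lift_snd _ _ _) w]
  have : B.div h.hom (𝟙 _ ≫ h.hom) w = 1 := by
    apply B.smul_left_injective (y := 𝟙 _ ≫ h.hom)
    rw [div_smul, one_smul, Category.id_comp]
  rw [this, one_smul]

/-- `(a, p) ↦ ((p / a, a), p)`. -/
def translation : pullback (h.hom ≫ B.f) B.f ⟶ pullback (snd G T.X ≫ h.hom ≫ B.f) B.f :=
  pullback.lift (lift (B.div _ _ (B.translation_condition h)) (pullback.fst (h.hom ≫ B.f) B.f))
    (pullback.snd _ _) (by rw [lift_snd_assoc, pullback.condition])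

/-- `((g, a), p) ↦ (g • a, p)`. -/
def pullbackAct : pullback (snd G T.X ≫ h.hom ≫ B.f) B.f ⟶ pullback (h.hom ≫ B.f) B.f :=
  ((Over.pullback B.f).map (B.actOver h)).left

/-- `((g, a), p) ↦ (a, p)`. -/
def pullbackSnd : pullback (snd G T.X ≫ h.hom ≫ B.f) B.f ⟶ pullback (h.hom ≫ B.f) B.f :=
  ((Over.pullback B.f).map (B.sndOver h)).left

lemma pullbackAct_fst : B.pullbackAct h ≫ pullback.fst _ _ = pullback.fst _ _ ≫ act T :=
  pullback.lift_fst _ _ _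

lemma pullbackAct_snd : B.pullbackAct h ≫ pullback.snd _ _ = pullback.snd _ _ :=
  pullback.lift_snd _ _ _

lemma pullbackSnd_fst : B.pullbackSnd h ≫ pullback.fst _ _ = pullback.fst _ _ ≫ snd G T.X :=
  pullback.lift_fst _ _ _

lemma pullbackSnd_snd : B.pullbackSnd h ≫ pullback.snd _ _ = pullback.snd _ _ :=
  pullback.lift_snd _ _ _

lemma translation_pullbackSnd : B.translation h ≫ B.pullbackSnd h = 𝟙 _ := by
  apply pullback.hom_ext
  · rw [Category.assoc, pullbackSnd_fst, translation, pullback.lift_fst_assoc, lift_snd,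
      Category.id_comp]
  · rw [Category.assoc, pullbackSnd_snd, translation, pullback.lift_snd, Category.id_comp]

lemma translation_pullbackAct :
    B.translation h ≫ B.pullbackAct h = B.translate h ≫ B.graph h := by
  apply pullback.hom_ext
  · rw [Category.assoc, pullbackAct_fst, translation, pullback.lift_fst_assoc, graph,
      Category.assoc, pullback.lift_fst, Category.comp_id]
    rfl
  · rw [Category.assoc, pullbackAct_snd, translation, pullback.lift_snd, graph,
      Category.assoc, pullback.lift_snd, translate_comp]

/-- Since `(p / (g • y)) * g = p / y`, replacing `a` by `g • a` does not change `(p / a) • a`. -/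
lemma pullbackAct_translate : B.pullbackAct h ≫ B.translate h =
    B.pullbackSnd h ≫ B.translate h := by
  let r := pullback.fst (snd G T.X ≫ h.hom ≫ B.f) B.f
  let p := pullback.snd (snd G T.X ≫ h.hom ≫ B.f) B.f
  have hr : r ≫ act T = (r ≫ fst G T.X) • (r ≫ snd G T.X) := by
    rw [Hom.smul_def, ← CartesianMonoidalCategory.comp_lift, lift_fst_snd, Category.comp_id]
    rfl
  have w : p ≫ B.f = ((r ≫ snd G T.X) ≫ h.hom) ≫ B.f := by
    simp only [r, p, Category.assoc]
    exact pullback.condition.symm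
  have w' : p ≫ B.f = ((r ≫ fst G T.X) • ((r ≫ snd G T.X) ≫ h.hom)) ≫ B.f := by
    rw [smul_comp_f, w]
  rw [B.comp_translate h (B.pullbackSnd h) (B.pullbackSnd_fst h) (B.pullbackSnd_snd h) w,
    B.comp_translate h (B.pullbackAct h) ((B.pullbackAct_fst h).trans hr) (B.pullbackAct_snd h)
      (by rw [IsModHom.map_smul]; exact w'), smul_smul]
  congr 1
  rw [← B.div_smul_right _ _ (r ≫ fst G T.X) w' w]
  congr 2
  rw [IsModHom.map_smul]

/-- The pair of morphisms `actOver`, `sndOver` is split after pulling back to the bundle. -/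
def isSplitCoequalizerTranslate :
    IsSplitCoequalizer ((Over.pullback B.f).map (B.actOver h))
      ((Over.pullback B.f).map (B.sndOver h))
      (Over.homMk (B.translate h) (B.translate_comp h) :
        (Over.pullback B.f).obj (Over.mk (h.hom ≫ B.f)) ⟶ Over.mk h.hom) where
  rightSection := Over.homMk (B.graph h) (pullback.lift_snd _ _ _)
  leftSection := Over.homMk (B.translation h) (pullback.lift_snd _ _ _)
  condition := Over.OverMorphism.ext (B.pullbackAct_translate h)
  rightSection_π := Over.OverMorphism.ext (B.graph_translate h)
  leftSection_bottom := Over.OverMorphism.ext (B.translation_pullbackSnd h)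
  leftSection_top := Over.OverMorphism.ext (B.translation_pullbackAct h)

variable {S : GObj G ⥤ C} {adj : S ⊣ trivialFunctor G}

/-- The base of the bundle, as a morphism into a trivial `G`-object. -/
def toTrivialBase : B.P ⟶ (trivialFunctor G).obj X := toTrivial B.f B.smul_f

variable {Q : C} {q : T ⟶ (trivialFunctor G).obj Q} {z : Q ⟶ X}

/-- A reflection of a `G`-object over the bundle, in the slice over the base. -/
def reflectionOver (w : q.hom ≫ z = h.hom ≫ B.f) :
    (Over.mk (h.hom ≫ B.f) : Over X) ⟶ Over.mk z :=
  Over.homMk (V := Over.mk z) q.hom w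

lemma reflectionOver_condition (w : q.hom ≫ z = h.hom ≫ B.f) :
    B.actOver h ≫ B.reflectionOver h w = B.sndOver h ≫ B.reflectionOver h w :=
  Over.OverMorphism.ext (act_comp_hom_trivial q)

/-- A reflection is a coequalizer in the slice over the base. -/
def reflectionOverIsColimit (hq : IsReflection adj q) (w : q.hom ≫ z = h.hom ≫ B.f) :
    IsColimit (Cofork.ofπ (B.reflectionOver h w) (B.reflectionOver_condition h w)) := by
  refine Cofork.IsColimit.mk' _ fun s => ?_
  have hs : act T ≫ s.π.left = snd G T.X ≫ s.π.left := congr(($s.condition).left)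
  have hl := hq.exists_eq (toTrivial s.π.left hs)
  have hw : hl.choose ≫ s.pt.hom = z := by
    apply hq.hom_ext
    rw [Functor.map_comp, reassoc_of% hl.choose_spec]
    exact Mod.hom_ext _ _ ((Over.w s.π).trans w.symm)
  refine ⟨Over.homMk hl.choose hw, Over.OverMorphism.ext congr(($hl.choose_spec).hom), ?_⟩
  intro m hm
  refine Over.OverMorphism.ext (hq.hom_ext (Eq.trans ?_ hl.choose_spec.symm))
  exact Mod.hom_ext _ _ congr(($hm).left)

/-- Over a principal bundle, the square exhibiting a `G`-object as the pullback of its reflection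
is a pullback. -/
lemma isPullback_of_isReflection (hq : IsReflection adj q)
    (w : h ≫ B.toTrivialBase = q ≫ (trivialFunctor G).map z) :
    IsPullback q h ((trivialFunctor G).map z) B.toTrivialBase := by
  have w' : q.hom ≫ z = h.hom ≫ B.f := congr(($w.symm).hom)
  obtain ⟨_⟩ := B.effectiveDescent
  let s := B.isSplitCoequalizerTranslate h
  have : (Over.pullback B.f).IsSplitPair (B.actOver h) (B.sndOver h) := ⟨_, _, ⟨s⟩⟩
  let _ := Monad.createsGSplitCoequalizersOfMonadic (Over.pullback B.f) (B.actOver h) (B.sndOver h)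
  have : HasColimit (parallelPair (B.actOver h) (B.sndOver h) ⋙ Over.pullback B.f) := by
    rw [hasColimit_iff_of_iso (diagramIsoParallelPair _)]
    exact inferInstanceAs (HasCoequalizer ((Over.pullback B.f).map (B.actOver h))
      ((Over.pullback B.f).map (B.sndOver h)))
  -- Monadicity makes `f^*` preserve the coequalizer given by the reflection. The split pair also
  -- has coequalizer `T`, so `T` is identified with `Q ×_X P`.
  let l := isColimitCoforkMapOfIsColimit (Over.pullback B.f) _ (B.reflectionOverIsColimit h hq w')
  let e : Over.mk h.hom ≅ (Over.pullback B.f).obj (Over.mk z) :=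
    s.isCoequalizer.coconePointUniqueUpToIso l
  -- Precomposing with the right section `a ↦ (a, h a)` makes the abstract isomorphism explicit, so
  -- that its projections can be computed.
  have he : e.hom = s.rightSection ≫ (Over.pullback B.f).map (B.reflectionOver h w') := by
    have : _ ≫ e.hom = (Over.pullback B.f).map (B.reflectionOver h w') :=
      s.isCoequalizer.comp_coconePointUniqueUpToIso_hom l WalkingParallelPair.one
    rw [← this]
    exact (s.rightSection_π_assoc e.hom).symm
  have hfst : e.hom.left ≫ pullback.fst z B.f = q.hom := by
    have h₁ : e.hom.left = B.graph h ≫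
        ((Over.pullback B.f).map (B.reflectionOver h w')).left := congr(($he).left)
    have h₂ : ((Over.pullback B.f).map (B.reflectionOver h w')).left ≫ pullback.fst z B.f =
        pullback.fst (h.hom ≫ B.f) B.f ≫ q.hom := pullback.lift_fst _ _ _
    have h₃ : B.graph h ≫ pullback.fst (h.hom ≫ B.f) B.f = 𝟙 _ := pullback.lift_fst _ _ _
    rw [h₁, Category.assoc]
    exact (congr(B.graph h ≫ $h₂)).trans (by rw [reassoc_of% h₃])
  have hsnd : e.hom.left ≫ pullback.snd z B.f = h.hom := Over.w e.hom
  have : IsIso e.hom.left := ((Over.forget _).mapIso e).isIso_hom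
  apply isPullback_of_hom
  exact (IsPullback.of_hasPullback z B.f).of_isIso_comp e.hom.left hfst hsnd

end Descent

end PrincipalBundle

lemma _root_.CategoryTheory.IsPullback.isIso_of_comp {C : Type u} [Category.{v} C] [HasPullbacks C]
    {T A B Z : C} {a : T ⟶ A} {b : T ⟶ B} {f : A ⟶ Z} {g : B ⟶ Z} (sq : IsPullback a b f g)
    {i : T ⟶ pullback f g} (ha : i ≫ pullback.fst f g = a) (hb : i ≫ pullback.snd f g = b) :
    IsIso i := by
  have : i = sq.isoPullback.hom := by
    apply pullback.hom_ext
    · rw [ha, IsPullback.isoPullback_hom_fst]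
    · rw [hb, IsPullback.isoPullback_hom_snd]
  rw [this]
  infer_instance

/-! ### From bundles to adjunctions -/

namespace PrincipalBundle

variable {C : Type u} [Category.{v} C] [CartesianMonoidalCategory C] [HasFiniteLimits C]
  {G : C} [GrpObj G] {X : C} (B : PrincipalBundle G X)

/-- Pulling back the bundle along a morphism to the base. -/
def pullbackFunctor : Over X ⥤ Over B.P :=
  Over.post (trivialFunctor G) ⋙ Over.pullback B.toTrivialBase

lemma isPullback_pullbackFunctor (W : Over X) :
    IsPullback (pullback.fst ((trivialFunctor G).map W.hom) B.toTrivialBase)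
      (pullback.snd ((trivialFunctor G).map W.hom) B.toTrivialBase)
      ((trivialFunctor G).map W.hom) B.toTrivialBase :=
  IsPullback.of_hasPullback _ _

lemma pullbackFunctor_map_fst {V W : Over X} (m : V ⟶ W) :
    (B.pullbackFunctor.map m).left ≫
        pullback.fst ((trivialFunctor G).map W.hom) B.toTrivialBase =
      pullback.fst ((trivialFunctor G).map V.hom) B.toTrivialBase ≫
        (trivialFunctor G).map m.left :=
  pullback.lift_fst _ _ _

lemma pullbackFunctor_map_snd {V W : Over X} (m : V ⟶ W) :
    (B.pullbackFunctor.map m).left ≫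
        pullback.snd ((trivialFunctor G).map W.hom) B.toTrivialBase =
      pullback.snd ((trivialFunctor G).map V.hom) B.toTrivialBase :=
  pullback.lift_snd _ _ _

/-- On underlying objects, `pullbackFunctor` is the pullback in the base category. -/
def pullbackFunctorForget : B.pullbackFunctor ⋙ Over.forget _ ⋙ Mod.forget (D := C) G ≅
    Over.pullback B.f ⋙ Over.forget _ :=
  NatIso.ofComponents
    (fun W => IsPullback.isoPullback (isPullback_hom (B.isPullback_pullbackFunctor W)))
    (fun {V W} m => IsPullback.isoPullback_naturality
      (isPullback_hom (B.isPullback_pullbackFunctor V))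
      (isPullback_hom (B.isPullback_pullbackFunctor W))
      (congr(Mod.Hom.hom $(B.pullbackFunctor_map_fst m)))
      (congr(Mod.Hom.hom $(B.pullbackFunctor_map_snd m))))

/-- On underlying objects this is `f^*`, which is monadic and hence conservative. -/
instance : B.pullbackFunctor.ReflectsIsomorphisms := by
  obtain ⟨_⟩ := B.effectiveDescent
  have : (Over.pullback B.f).ReflectsIsomorphisms :=
    reflectsIsomorphisms_of_iso (Monad.comparisonForget (monadicAdjunction (Over.pullback B.f)))
  have : (B.pullbackFunctor ⋙ Over.forget _ ⋙ Mod.forget (D := C) G).ReflectsIsomorphisms :=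
    reflectsIsomorphisms_of_iso B.pullbackFunctorForget.symm
  exact reflectsIsomorphisms_of_comp _ (Over.forget _ ⋙ Mod.forget (D := C) G)

variable {S : GObj G ⥤ C} (adj : S ⊣ trivialFunctor G)

/-- The left adjoint of `pullbackFunctor`. -/
def quotientFunctor : Over B.P ⥤ Over X :=
  Over.map B.toTrivialBase ⋙ Over.post S ⋙ Over.map (adj.counit.app X)

/-- The adjunction between quotients and pullbacks. -/
def quotientAdj : B.quotientFunctor adj ⊣ B.pullbackFunctor :=
  (Over.mapPullbackAdj B.toTrivialBase).comp (Over.postAdjunctionRight adj)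

lemma quotientAdj_counit_left (W : Over X) : ((B.quotientAdj adj).counit.app W).left =
    S.map (pullback.fst ((trivialFunctor G).map W.hom) B.toTrivialBase) ≫
      adj.counit.app W.left := by
  have h : ((Over.mapPullbackAdj B.toTrivialBase).counit.app
      ((Over.post (trivialFunctor G)).obj W)).left =
        pullback.fst ((trivialFunctor G).map W.hom) B.toTrivialBase := by
    rw [Over.mapPullbackAdj_counit_app]
    rfl
  rw [← h, quotientAdj, Adjunction.comp_counit_app]
  rfl

lemma quotientAdj_unit_left_fst (T : Over B.P) :
    ((B.quotientAdj adj).unit.app T).left ≫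
      pullback.fst ((trivialFunctor G).map ((B.quotientFunctor adj).obj T).hom) B.toTrivialBase =
    adj.unit.app T.left := by
  let k : (Over.map B.toTrivialBase).obj T ⟶
      (Over.post (trivialFunctor G)).obj ((B.quotientFunctor adj).obj T) :=
    (Over.postAdjunctionRight adj).unit.app ((Over.map B.toTrivialBase).obj T)
  have h₁ : ((Over.pullback B.toTrivialBase).map k).left ≫
      pullback.fst ((trivialFunctor G).map ((B.quotientFunctor adj).obj T).hom) B.toTrivialBase =
      pullback.fst ((Over.map B.toTrivialBase).obj T).hom B.toTrivialBase ≫ k.left :=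
    pullback.lift_fst _ _ _
  have h₂ : ((Over.mapPullbackAdj B.toTrivialBase).unit.app T).left ≫
      pullback.fst ((Over.map B.toTrivialBase).obj T).hom B.toTrivialBase = 𝟙 T.left := by
    rw [Over.mapPullbackAdj_unit_app]
    exact pullback.lift_fst _ _ _
  have h₃ : ((B.quotientAdj adj).unit.app T).left =
      ((Over.mapPullbackAdj B.toTrivialBase).unit.app T).left ≫
        ((Over.pullback B.toTrivialBase).map k).left := by
    rw [quotientAdj, Adjunction.comp_unit_app]
    rfl
  rw [h₃]
  refine (Category.assoc _ _ _).trans (congr(_ ≫ $h₁).trans ?_)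
  refine (Category.assoc _ _ _).symm.trans ?_
  rw [h₂]
  exact Category.id_comp _

/-- The unit compares `T` with `Σ_G T ×_X P`, and descent along the bundle makes `T` itself such a
pullback. -/
instance (T : Over B.P) : IsIso ((B.quotientAdj adj).unit.app T) := by
  let i := ((B.quotientAdj adj).unit.app T).left
  let q : T.left ⟶ (trivialFunctor G).obj (S.obj T.left) := adj.unit.app T.left
  let z : S.obj T.left ⟶ X := ((B.quotientFunctor adj).obj T).hom
  have hfst : i ≫ pullback.fst ((trivialFunctor G).map z) B.toTrivialBase = q :=
    B.quotientAdj_unit_left_fst adj T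
  have hsnd : i ≫ pullback.snd ((trivialFunctor G).map z) B.toTrivialBase = T.hom :=
    Over.w ((B.quotientAdj adj).unit.app T)
  have hq : IsReflection adj q := by
    have : (adj.homEquiv _ _).symm q = 𝟙 _ :=
      (Equiv.symm_apply_eq _).2 (adj.homEquiv_id _).symm
    rw [IsReflection, this]
    infer_instance
  have w : T.hom ≫ B.toTrivialBase = q ≫ (trivialFunctor G).map z := by
    rw [← hfst, ← hsnd]
    exact (Category.assoc _ _ _).trans
      (congr(i ≫ $(pullback.condition.symm)).trans (Category.assoc _ _ _).symm)
  have : IsIso ((Over.forget B.P).map ((B.quotientAdj adj).unit.app T)) :=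
    (B.isPullback_of_isReflection T.hom hq w).isIso_of_comp hfst hsnd
  exact isIso_of_reflects_iso _ (Over.forget B.P)

/-- As the unit is invertible, a triangle identity makes the image of the counit under the
conservative `pullbackFunctor` invertible. -/
instance (W : Over X) : IsIso ((B.quotientAdj adj).counit.app W) := by
  have : IsIso (B.pullbackFunctor.map ((B.quotientAdj adj).counit.app W)) :=
    IsIso.of_isIso_fac_left ((B.quotientAdj adj).right_triangle_components W)
  exact isIso_of_reflects_iso _ B.pullbackFunctor

/-- Over a principal bundle, `G`-objects are equivalent to objects over the base. -/
def quotientEquivalence : Over B.P ≌ Over X := (B.quotientAdj adj).toEquivalence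

/-- The adjunction associated to a principal bundle. -/
def toAdjunctionOver : StablyFrobeniusAdjunctionOver S X where
  L := B.pullbackFunctor ⋙ Over.forget B.P
  R := Over.star B.P ⋙ B.quotientFunctor adj
  adj := (B.quotientEquivalence adj).symm.toAdjunction.comp (Over.forgetAdjStar B.P)
  overIso := NatIso.ofComponents
    (fun W => (Over.forget X).mapIso (asIso ((B.quotientAdj adj).counit.app W)))
    (fun m => congr(($((B.quotientAdj adj).counit.naturality m)).left))
  stablyFrobenius :=
    (isStablyFrobenius_of_isEquivalence (B.quotientEquivalence adj).symm.toAdjunction).comp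
      (isStablyFrobenius_forgetAdjStar B.P)

/-- The isomorphism over `C` is the counit, whose transpose is the projection of the pullback. At
`1` this recovers the bundle morphism. -/
lemma toAdjunctionOver_toBase (W : Over X) : (B.toAdjunctionOver adj).toBase adj W =
    pullback.fst ((trivialFunctor G).map W.hom) B.toTrivialBase := by
  apply (adj.homEquiv _ _).symm.injective
  rw [StablyFrobeniusAdjunctionOver.toBase, Equiv.symm_apply_apply]
  exact (B.quotientAdj_counit_left adj W).trans (adj.homEquiv_counit _ _ _).symm

/-- The bundle of the adjunction associated to a principal bundle is the given one. -/
def toAdjunctionOverIso : (B.toAdjunctionOver adj).toPrincipalBundle adj ≅ B := by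
  let p : pullback ((trivialFunctor G).map (𝟙 X)) B.toTrivialBase ⟶ B.P := pullback.snd _ _
  have : IsIso ((trivialFunctor G).map (𝟙 X)) := inferInstance
  -- At the terminal object the pullback is along an identity, so it returns `P`.
  have : IsIso p :=
    (IsPullback.of_hasPullback ((trivialFunctor G).map (𝟙 X)) B.toTrivialBase).isIso_snd_of_isIso
  have hp : p.hom ≫ B.f = (B.toAdjunctionOver adj).proj adj := by
    have h₁ : pullback.fst ((trivialFunctor G).map (𝟙 X)) B.toTrivialBase =
        p ≫ B.toTrivialBase := by
      rw [← pullback.condition, CategoryTheory.Functor.map_id, Category.comp_id]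
    exact (congr(Mod.Hom.hom $((B.toAdjunctionOver_toBase adj (Over.mk (𝟙 X))).trans h₁))).symm
  let e := asIso p
  have hp' : e.inv.hom ≫ p.hom ≫ B.f = B.f := by
    have : e.inv.hom ≫ p.hom = 𝟙 _ := congr(Mod.Hom.hom $(e.inv_hom_id))
    rw [← Category.assoc, this, Category.id_comp]
  exact
  { hom := ⟨p, hp⟩
    inv := ⟨e.inv, congr(e.inv.hom ≫ $hp).symm.trans hp'⟩
    hom_inv_id := PrincipalBundle.Hom.ext e.hom_inv_id
    inv_hom_id := PrincipalBundle.Hom.ext e.inv_hom_id }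

instance : (StablyFrobeniusAdjunctionOver.toPrincipalBundleFunctor (X := X) adj).EssSurj where
  mem_essImage B := ⟨B.toAdjunctionOver adj, ⟨B.toAdjunctionOverIso adj⟩⟩

end PrincipalBundle
end PrincipalBundles

end

theorem mainTheorem1 {C : Type u} [CategoryTheory.Category.{v} C]
    [CategoryTheory.CartesianMonoidalCategory C] [CategoryTheory.Limits.HasFiniteLimits C]
    (G : C) [CategoryTheory.GrpObj G]
    (S : PrincipalBundles.GObj G ⥤ C) (adj : S ⊣ PrincipalBundles.trivialFunctor G)
    (hadj : PrincipalBundles.IsStablyFrobenius adj) (X : C) :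
    Nonempty (PrincipalBundles.PrincipalBundle G X ≌
      PrincipalBundles.StablyFrobeniusAdjunctionOver S X) := by
  have : (PrincipalBundles.StablyFrobeniusAdjunctionOver.toPrincipalBundleFunctor
    (X := X) adj).IsEquivalence := {}
  exact ⟨(PrincipalBundles.StablyFrobeniusAdjunctionOver.toPrincipalBundleFunctor
    (X := X) adj).asEquivalence.symm⟩
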